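/- Let $E$ be a real Banach lattice that is $\sigma$-Dedekind complete, i.e. every nonempty countable subset of $E$ that is bounded above (below) has a supremum (infimum). Let $E^*$ be the norm dual of $E$ with its dual lattice order ($f\le g$ iff $f(x)\le g(x)$ for all $0\le x\in E$), and let $(f_n)$ be a weak$^*$ convergent sequence in $E^*$. If $(g_n)$ is a disjoint sequence in $E^*$ (i.e. $|g_m|\wedge|g_n|=0$ whenever $m\ne n$) satisfying $|g_n|\le|f_n|$ for each $n\in\mathbb{N}$, then the sequences $(g_n)$, $(|g_n|)$, $(g_n^+)$, $(g_n^-)$ all converge weak$^*$ to zero. In particular, if $(f_n)$ is itself a disjoint weak$^*$ convergent sequence, then the sequences $(f_n)$, $(|f_n|)$, $(f_n^+)$, $(f_n^-)$ are all weak$^*$ null. -/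

import Mathlib

open Filter Topology

/-- A partially ordered set is `σ`-Dedekind complete if every nonempty countable subset that is
bounded above has a supremum and every nonempty countable subset that is bounded below has an
infimum. -/
def SigmaDedekindComplete (E : Type*) [PartialOrder E] : Prop :=
  (∀ s : Set E, s.Countable → s.Nonempty → BddAbove s → ∃ a, IsLUB s a) ∧
    (∀ s : Set E, s.Countable → s.Nonempty → BddBelow s → ∃ a, IsGLB s a)

/-- A sequence in a vector lattice is disjoint if its terms with different indices are
disjoint elements: `|u m| ⊓ |u n| = 0`. -/
def DisjointSeq {V : Type*} [Lattice V] [AddCommGroup V] (u : ℕ → V) : Prop :=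
  ∀ m n : ℕ, m ≠ n → |u m| ⊓ |u n| = 0

namespace BanachLatticeDual

variable {E : Type*} [NormedAddCommGroup E] [Lattice E] [IsOrderedAddMonoid E] [HasSolidNorm E]
  [NormedSpace ℝ E]

/-- The dual order on the norm dual `E*` of a normed lattice (`WeakDual ℝ E` is `E*`, the space of
all continuous linear functionals, with the weak* topology): `f ≤ g` iff `f x ≤ g x` for every
`x ≥ 0`. -/
instance instPartialOrder : PartialOrder (WeakDual ℝ E) where
  le f g := ∀ x : E, 0 ≤ x → f x ≤ g x
  le_refl f x _ := le_rfl
  le_trans f g h hfg hgh x hx := (hfg x hx).trans (hgh x hx)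
  le_antisymm f g hfg hgf := by
    have h : ∀ x : E, 0 ≤ x → f x = g x := fun x hx => le_antisymm (hfg x hx) (hgf x hx)
    refine DFunLike.ext f g fun x => ?_
    rw [← posPart_sub_negPart x, map_sub, map_sub, h _ (posPart_nonneg x),
      h _ (negPart_nonneg x)]

instance instIsOrderedAddMonoid : IsOrderedAddMonoid (WeakDual ℝ E) where
  add_le_add_left f g h k x hx := by
    change f x + k x ≤ g x + k x
    exact add_le_add_left (h x hx) _

/-- The Riesz-Kantorovich formula on the positive cone: `sup {f y : 0 ≤ y ≤ x}`. -/
noncomputable def posSup (f : WeakDual ℝ E) (x : E) : ℝ :=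
  sSup ((fun y => f y) '' Set.Icc 0 x)

theorem apply_le_of_mem (f : WeakDual ℝ E) {x y : E} (hy : y ∈ Set.Icc 0 x) :
    f y ≤ ‖WeakDual.toStrongDual f‖ * ‖x‖ := by
  have h1 : ‖y‖ ≤ ‖x‖ := by
    apply norm_le_norm_of_abs_le_abs
    rw [abs_of_nonneg hy.1, abs_of_nonneg (hy.1.trans hy.2)]
    exact hy.2
  calc f y ≤ ‖(WeakDual.toStrongDual f) y‖ := le_abs_self _
    _ ≤ ‖WeakDual.toStrongDual f‖ * ‖y‖ := ContinuousLinearMap.le_opNorm _ _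
    _ ≤ _ := by gcongr

theorem isLUB_posSup (f : WeakDual ℝ E) {x : E} (hx : 0 ≤ x) :
    IsLUB ((fun y => f y) '' Set.Icc 0 x) (posSup f x) := by
  refine isLUB_csSup ⟨f 0, 0, ⟨le_rfl, hx⟩, rfl⟩ ⟨‖WeakDual.toStrongDual f‖ * ‖x‖, ?_⟩
  rintro _ ⟨y, hy, rfl⟩
  exact apply_le_of_mem f hy

theorem le_posSup (f : WeakDual ℝ E) {x y : E} (hy : 0 ≤ y) (hyx : y ≤ x) :
    f y ≤ posSup f x :=
  (isLUB_posSup f (hy.trans hyx)).1 ⟨y, ⟨hy, hyx⟩, rfl⟩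

theorem posSup_le (f : WeakDual ℝ E) {x : E} (hx : 0 ≤ x) {c : ℝ}
    (h : ∀ y, 0 ≤ y → y ≤ x → f y ≤ c) : posSup f x ≤ c := by
  refine (isLUB_posSup f hx).2 ?_
  rintro _ ⟨y, hy, rfl⟩
  exact h y hy.1 hy.2

theorem posSup_nonneg (f : WeakDual ℝ E) {x : E} (hx : 0 ≤ x) : 0 ≤ posSup f x := by
  simpa using le_posSup f le_rfl hx

theorem posSup_add (f : WeakDual ℝ E) {a b : E} (ha : 0 ≤ a) (hb : 0 ≤ b) :
    posSup f (a + b) = posSup f a + posSup f b := by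
  apply le_antisymm
  · refine posSup_le f (add_nonneg ha hb) fun y hy hyab => ?_
    have h1 : y = y ⊓ a + (y - y ⊓ a) := by abel
    have h2 : y - y ⊓ a ≤ b := by
      rw [sub_le_iff_le_add, add_comm, inf_add]
      exact le_inf (le_add_of_nonneg_right hb) hyab
    rw [h1, map_add]
    exact add_le_add (le_posSup f (le_inf hy ha) inf_le_right)
      (le_posSup f (sub_nonneg.2 inf_le_left) h2)
  · rw [← le_sub_iff_add_le]
    refine posSup_le f ha fun y hy hya => ?_
    rw [le_sub_comm]
    refine posSup_le f hb fun z hz hzb => ?_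
    rw [le_sub_iff_add_le, add_comm, ← map_add]
    exact le_posSup f (add_nonneg hy hz) (add_le_add hya hzb)

theorem posSup_sub_eq (f : WeakDual ℝ E) {a b c d : E} (ha : 0 ≤ a) (hb : 0 ≤ b) (hc : 0 ≤ c)
    (hd : 0 ≤ d) (h : a - b = c - d) :
    posSup f a - posSup f b = posSup f c - posSup f d := by
  have h1 : a + d = c + b := sub_eq_sub_iff_add_eq_add.1 h
  have h2 := posSup_add f ha hd
  rw [h1, posSup_add f hc hb] at h2
  linarith

/-- The additive extension of `posSup f` to all of `E`. -/
noncomputable def posAddHom (f : WeakDual ℝ E) : E →+ ℝ :=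
  AddMonoidHom.mk' (fun x => posSup f x⁺ - posSup f x⁻) (by
    intro x y
    have h := posSup_sub_eq f (posPart_nonneg (x + y)) (negPart_nonneg (x + y))
      (add_nonneg (posPart_nonneg x) (posPart_nonneg y))
      (add_nonneg (negPart_nonneg x) (negPart_nonneg y)) (by
        rw [add_sub_add_comm, posPart_sub_negPart, posPart_sub_negPart, posPart_sub_negPart])
    rw [posSup_add f (posPart_nonneg x) (posPart_nonneg y),
      posSup_add f (negPart_nonneg x) (negPart_nonneg y)] at h
    linarith)

theorem posAddHom_continuous (f : WeakDual ℝ E) : Continuous (posAddHom f) := by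
  refine AddMonoidHomClass.continuous_of_bound (posAddHom f)
    ‖WeakDual.toStrongDual f‖ fun x => ?_
  have key : ∀ y : E, 0 ≤ y → y ≤ |x| → posSup f y ≤ ‖WeakDual.toStrongDual f‖ * ‖x‖ := by
    intro y hy hyx
    refine posSup_le f hy fun z hz hzy => ?_
    have := apply_le_of_mem f (x := |x|) ⟨hz, hzy.trans hyx⟩
    rwa [norm_abs_eq_norm] at this
  have h1 := key x⁺ (posPart_nonneg x) (sup_le (le_abs_self x) (abs_nonneg x))
  have h2 := key x⁻ (negPart_nonneg x) (sup_le (neg_le_abs x) (abs_nonneg x))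
  have h3 := posSup_nonneg f (posPart_nonneg x)
  have h4 := posSup_nonneg f (negPart_nonneg x)
  change |posSup f x⁺ - posSup f x⁻| ≤ _
  rw [abs_le]
  constructor <;> linarith

/-- The positive part of a continuous linear functional. -/
noncomputable def posFun (f : WeakDual ℝ E) : WeakDual ℝ E :=
  StrongDual.toWeakDual ((posAddHom f).toRealLinearMap (posAddHom_continuous f))

theorem posFun_apply (f : WeakDual ℝ E) {x : E} (hx : 0 ≤ x) : posFun f x = posSup f x := by
  have h : posSup f (0 : E) = 0 :=
    le_antisymm (posSup_le f le_rfl fun y hy hy0 => by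
      rw [le_antisymm hy0 hy, map_zero]) (posSup_nonneg f le_rfl)
  change posSup f x⁺ - posSup f x⁻ = _
  rw [posPart_of_nonneg hx, negPart_of_nonneg hx, h, sub_zero]

/-- The norm dual of a normed lattice is a lattice in the dual order. -/
noncomputable instance instLattice : Lattice (WeakDual ℝ E) :=
  { instPartialOrder with
    sup := fun f g => g + posFun (f - g)
    inf := fun f g => f - posFun (f - g)
    le_sup_left := fun f g x hx => by
      change f x ≤ g x + posFun (f - g) x
      rw [posFun_apply _ hx]
      have h : f x - g x ≤ _ := le_posSup (f - g) hx le_rfl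
      linarith
    le_sup_right := fun f g x hx => by
      change g x ≤ g x + posFun (f - g) x
      rw [posFun_apply _ hx]
      have h := posSup_nonneg (f - g) hx
      linarith
    sup_le := fun f g h hfh hgh x hx => by
      change g x + posFun (f - g) x ≤ h x
      rw [posFun_apply _ hx]
      have h1 : posSup (f - g) x ≤ h x - g x := by
        refine posSup_le _ hx fun y hy hyx => ?_
        change f y - g y ≤ _
        have h2 := hfh y hy
        have h3 := hgh (x - y) (sub_nonneg.2 hyx)
        rw [map_sub, map_sub] at h3
        linarith
      linarith
    inf_le_left := fun f g x hx => by
      change f x - posFun (f - g) x ≤ f x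
      rw [posFun_apply _ hx]
      have h := posSup_nonneg (f - g) hx
      linarith
    inf_le_right := fun f g x hx => by
      change f x - posFun (f - g) x ≤ g x
      rw [posFun_apply _ hx]
      have h : f x - g x ≤ _ := le_posSup (f - g) hx le_rfl
      linarith
    le_inf := fun h f g hhf hhg x hx => by
      change h x ≤ f x - posFun (f - g) x
      rw [posFun_apply _ hx]
      have h1 : posSup (f - g) x ≤ f x - h x := by
        refine posSup_le _ hx fun y hy hyx => ?_
        change f y - g y ≤ _
        have h2 := hhg y hy
        have h3 := hhf (x - y) (sub_nonneg.2 hyx)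
        rw [map_sub, map_sub] at h3
        linarith
      linarith }

end BanachLatticeDual

/-! Suppose |g_n| x ≥ ε along a subsequence, for some x ≥ 0. Disjointness passes from functionals to
vectors: `exists_disjoint_le_apply` gives, along a further subsequence, disjoint y_j in [0, x] with
|g_n| y_j ≥ ε/2. As |g_n| ≤ |f_n|, some z_j in [0, y_j] has |f_n z_j| > ε/8.

This contradicts `tendsto_apply_of_tendsto`: a weak* convergent sequence vanishes along order
bounded disjoint vectors. Once the limit is subtracted, σ-Dedekind completeness makes S A = ⋁_{j ∈
A} z_j additive, Rosenthal's lemma finds an infinite M with |h_k|(S (M \ {k})) small for k in M, and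
convergence at the single vector S M then makes h_k z_k small.

Finally, |g_n| → 0 on the positive cone dominates all four sequences. -/

section Lattice

/-! ### Disjointness and countable suprema in lattice-ordered groups -/

variable {V : Type*} [Lattice V] [AddCommGroup V] [IsOrderedAddMonoid V]

theorem add_inf_eq_zero_of_inf_eq_zero {a b c : V} (ha : 0 ≤ a) (hb : 0 ≤ b) (hc : 0 ≤ c)
    (hac : a ⊓ c = 0) (hbc : b ⊓ c = 0) : (a + b) ⊓ c = 0 := by
  apply le_antisymm _ (le_inf (add_nonneg ha hb) hc)
  have h : (a + b) ⊓ c ≤ a := by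
    calc (a + b) ⊓ c ≤ (a + b) ⊓ (a + c) := inf_le_inf_left _ (le_add_of_nonneg_left ha)
      _ = a := by rw [← add_inf, hbc, add_zero]
  rw [← hac]
  exact le_inf h inf_le_right

theorem sum_inf_eq_zero_of_inf_eq_zero {ι : Type*} (s : Finset ι) (u : ι → V) {c : V}
    (hc : 0 ≤ c) (hu : ∀ i ∈ s, 0 ≤ u i) (h : ∀ i ∈ s, u i ⊓ c = 0) :
    (∑ i ∈ s, u i) ⊓ c = 0 := by
  classical
  induction s using Finset.induction_on with
  | empty => simpa using hc
  | insert k s hk ih =>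
    rw [Finset.sum_insert hk]
    simp only [Finset.mem_insert, forall_eq_or_imp] at hu h
    exact add_inf_eq_zero_of_inf_eq_zero hu.1 (Finset.sum_nonneg hu.2) hc h.1 (ih hu.2 h.2)

theorem add_le_of_inf_eq_zero {a b c : V} (h : a ⊓ b = 0) (ha : a ≤ c) (hb : b ≤ c) :
    a + b ≤ c := by
  rw [← inf_add_sup a b, h, zero_add]
  exact sup_le ha hb

theorem posPart_inf_posPart_eq_zero {s t : V} (h : s ≤ -t) : s⁺ ⊓ t⁺ = 0 := by
  apply le_antisymm _ (le_inf (posPart_nonneg s) (posPart_nonneg t))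
  calc s⁺ ⊓ t⁺ ≤ (-t)⁺ ⊓ t⁺ := inf_le_inf_right _ (posPart_mono h)
    _ = 0 := by rw [posPart_neg, inf_comm, posPart_inf_negPart_eq_zero]

/-- A `σ`-Dedekind complete vector lattice has a finitely additive set function `A ↦ ⋁_{j ∈ A} z j`
for every positive disjoint sequence `z` bounded by `x`. -/
theorem SigmaDedekindComplete.exists_supFun (hE : SigmaDedekindComplete V) {x : V} {z : ℕ → V}
    (hx : 0 ≤ x) (hz0 : ∀ j, 0 ≤ z j) (hzx : ∀ j, z j ≤ x)
    (hd : ∀ i j, i ≠ j → z i ⊓ z j = 0) :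
    ∃ S : Set ℕ → V, (∀ A, 0 ≤ S A) ∧ (∀ A, S A ≤ x) ∧ (∀ j, S {j} = z j) ∧
      ∀ A B, Disjoint A B → S (A ∪ B) = S A + S B := by
  -- Inserting 0 covers A = ∅ and makes every S A nonnegative.
  have hex : ∀ A : Set ℕ, ∃ a, IsLUB (insert 0 (z '' A)) a := fun A => by
    refine hE.1 _ ((A.to_countable.image z).insert 0) (Set.insert_nonempty _ _) ⟨x, ?_⟩
    rintro _ (rfl | ⟨j, -, rfl⟩)
    exacts [hx, hzx j]
  choose S hS using hex
  have h0 : ∀ A, 0 ≤ S A := fun A => (hS A).1 (Set.mem_insert _ _)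
  have hle : ∀ A, ∀ j ∈ A, z j ≤ S A := fun A j hj => (hS A).1 (Or.inr ⟨j, hj, rfl⟩)
  have hub : ∀ A c, 0 ≤ c → (∀ j ∈ A, z j ≤ c) → S A ≤ c := by
    intro A c hc h
    refine (hS A).2 ?_
    rintro _ (rfl | ⟨j, hj, rfl⟩)
    exacts [hc, h j hj]
  have hmono : ∀ A B, A ⊆ B → S A ≤ S B := fun A B h =>
    hub A _ (h0 B) fun j hj => hle B j (h hj)
  refine ⟨S, h0, fun A => hub A x hx fun j _ => hzx j, fun j => ?_, fun A B hAB => ?_⟩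
  · exact le_antisymm (hub _ _ (hz0 j) (by rintro _ rfl; exact le_rfl)) (hle _ j rfl)
  · apply le_antisymm
    · refine hub _ _ (add_nonneg (h0 A) (h0 B)) ?_
      rintro j (hj | hj)
      · exact (hle A j hj).trans (le_add_of_nonneg_right (h0 B))
      · exact (hle B j hj).trans (le_add_of_nonneg_left (h0 A))
    -- Disjoint z a and z b below S (A ∪ B) have their sum below it; take suprema over b, then over
    -- a.
    · have hB : ∀ a ∈ A, S B ≤ S (A ∪ B) - z a := by
        intro a ha
        refine hub _ _ (sub_nonneg.2 (hle _ a (Or.inl ha))) fun b hb => ?_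
        rw [le_sub_iff_add_le]
        refine add_le_of_inf_eq_zero (hd b a ?_) (hle _ b (Or.inr hb)) (hle _ a (Or.inl ha))
        rintro rfl
        exact Set.disjoint_left.1 hAB ha hb
      rw [← le_sub_iff_add_le]
      refine hub _ _ (sub_nonneg.2 (hmono _ _ Set.subset_union_right)) fun a ha => ?_
      rw [le_sub_comm]
      exact hB a ha

end Lattice

/-- **Rosenthal's lemma** for nonnegative superadditive set functions on `ℕ`. -/
theorem exists_infinite_subset_diff_singleton_lt (ν : ℕ → Set ℕ → ℝ) (h0 : ∀ k A, 0 ≤ ν k A)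
    (hadd : ∀ k A B, Disjoint A B → ν k A + ν k B ≤ ν k (A ∪ B)) {δ : ℝ} (hδ : 0 < δ) (N : ℕ) :
    ∀ M : Set ℕ, M.Infinite → (∀ k ∈ M, ν k M ≤ N * δ) →
      ∃ M' ⊆ M, M'.Infinite ∧ ∀ k ∈ M', ν k (M' \ {k}) < δ := by
  have hmono : ∀ k A B, A ⊆ B → ν k A ≤ ν k B := by
    intro k A B h
    have h1 := hadd k A (B \ A) Set.disjoint_sdiff_right
    rw [Set.union_sdiff_cancel h] at h1
    linarith [h0 k (B \ A)]
  induction N with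
  | zero =>
    intro M hM hb
    refine ⟨M, le_rfl, hM, fun k hk => ?_⟩
    have h1 := hmono k (M \ {k}) M Set.sdiff_subset
    have h2 := hb k hk
    simp only [Nat.cast_zero, zero_mul] at h2
    linarith
  | succ N ih =>
    intro M hM hb
    let e : ℕ ↪ M := hM.natEmbedding
    -- Infinitely many pairwise disjoint infinite pieces of M.
    let P : ℕ → Set ℕ := fun p => Set.range fun q => (e (Nat.pair p q) : ℕ)
    have hPM : ∀ p, P p ⊆ M := by
      rintro p _ ⟨q, rfl⟩
      exact (e _).2
    have hPd : ∀ p p' a, a ∈ P p → a ∈ P p' → p = p' := by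
      rintro p p' _ ⟨q, rfl⟩ ⟨q', h⟩
      have h1 := e.injective (Subtype.ext h)
      exact (Nat.pair_eq_pair.1 h1).1.symm
    have hPi : ∀ p, (P p).Infinite := fun p =>
      Set.infinite_range_of_injective fun q q' h =>
        (Nat.pair_eq_pair.1 (e.injective (Subtype.ext h))).2
    by_cases hgood : ∃ p, ∀ k ∈ P p, ν k (P p \ {k}) < δ
    · obtain ⟨p, hp⟩ := hgood
      exact ⟨P p, hPM p, hPi p, hp⟩
    push Not at hgood
    choose k hkP hk using hgood
    have hkM : Set.range k ⊆ M := by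
      rintro _ ⟨p, rfl⟩
      exact hPM p (hkP p)
    have hki : (Set.range k).Infinite := Set.infinite_range_of_injective fun p p' h =>
      hPd p p' (k p) (hkP p) (h ▸ hkP p')
    -- Mass at least δ of ν (k p) sits on P p \ {k p}, off the range of k, so the bound drops by δ.
    obtain ⟨M', hM', hinf, hlt⟩ := ih (Set.range k) hki (by
      rintro _ ⟨p, rfl⟩
      have hdis : Disjoint (P p \ {k p}) (Set.range k) := by
        rw [Set.disjoint_left]
        rintro a ⟨ha, hne⟩ ⟨p', rfl⟩
        have := hPd p p' _ ha (hkP p')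
        subst this
        exact hne rfl
      have h1 := hadd (k p) _ _ hdis
      have h2 := hmono (k p) (P p \ {k p} ∪ Set.range k) M
        (Set.union_subset (Set.sdiff_subset.trans (hPM p)) hkM)
      have h3 := hb (k p) (hPM p (hkP p))
      push_cast at h3
      linarith [hk p])
    exact ⟨M', hM'.trans hkM, hinf, hlt⟩

set_option linter.unusedSectionVars false

namespace BanachLatticeDual

variable {E : Type*} [NormedAddCommGroup E] [Lattice E] [IsOrderedAddMonoid E] [HasSolidNorm E]
  [NormedSpace ℝ E]

/-! ### Evaluating functionals on the positive cone -/

theorem apply_nonneg {f : WeakDual ℝ E} (hf : 0 ≤ f) {x : E} (hx : 0 ≤ x) : 0 ≤ f x :=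
  hf x hx

theorem apply_mono {f : WeakDual ℝ E} (hf : 0 ≤ f) {x y : E} (h : x ≤ y) : f x ≤ f y := by
  have := apply_nonneg hf (sub_nonneg.2 h)
  rw [map_sub] at this
  exact sub_nonneg.1 this

theorem sum_apply {ι : Type*} (s : Finset ι) (f : ι → WeakDual ℝ E) (x : E) :
    (∑ i ∈ s, f i) x = ∑ i ∈ s, f i x := by
  classical
  induction s using Finset.induction_on with
  | empty => simp only [Finset.sum_empty]; rfl
  | insert k s hk ih => rw [Finset.sum_insert hk, Finset.sum_insert hk, ← ih]; rfl

theorem abs_apply_le_abs_apply (f : WeakDual ℝ E) {x : E} (hx : 0 ≤ x) : |f x| ≤ |f| x :=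
  abs_le'.2 ⟨le_abs_self f x hx, neg_le_abs f x hx⟩

theorem abs_apply_le_abs_apply_abs (f : WeakDual ℝ E) (x : E) : |f x| ≤ |f| |x| := by
  have h1 := abs_apply_le_abs_apply f (posPart_nonneg x)
  have h2 := abs_apply_le_abs_apply f (negPart_nonneg x)
  calc |f x| = |f x⁺ - f x⁻| := by rw [← map_sub, posPart_sub_negPart]
    _ ≤ |f x⁺| + |f x⁻| := abs_sub _ _
    _ ≤ |f| x⁺ + |f| x⁻ := add_le_add h1 h2
    _ = |f| |x| := by rw [← map_add, posPart_add_negPart]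

/-- By construction |f| = -f + (2f)⁺, whose terms cost c and 2c at x. -/
theorem abs_apply_le_of_forall_le (f : WeakDual ℝ E) {x : E} (hx : 0 ≤ x) {c : ℝ}
    (h : ∀ y, 0 ≤ y → y ≤ x → |f y| ≤ c) : |f| x ≤ 3 * c := by
  change (-f) x + posFun (f - -f) x ≤ _
  rw [posFun_apply _ hx]
  have h1 : posSup (f - -f) x ≤ 2 * c := by
    refine posSup_le _ hx fun y hy hyx => ?_
    change f y - -f y ≤ _
    linarith [(abs_le.1 (h y hy hyx)).2]
  change -f x + _ ≤ _
  linarith [(abs_le.1 (h x hx le_rfl)).1]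

/-! ### From disjoint functionals to disjoint vectors -/

/-- By Riesz–Kantorovich, (f ⊓ g) x is the infimum of f (x - a) + g a over a in [0, x]. -/
theorem exists_apply_sub_add_apply_lt {f g : WeakDual ℝ E} (hfg : f ⊓ g = 0) {x : E} (hx : 0 ≤ x)
    {η : ℝ} (hη : 0 < η) : ∃ a, 0 ≤ a ∧ a ≤ x ∧ f (x - a) + g a < η := by
  have h : f x - posFun (f - g) x = 0 := congrArg (fun k : WeakDual ℝ E => k x) hfg
  rw [posFun_apply _ hx] at h
  by_contra! hcon
  have : posSup (f - g) x ≤ f x - η := by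
    refine posSup_le _ hx fun y hy hyx => ?_
    change f y - g y ≤ _
    have := hcon y hy hyx
    rw [map_sub] at this
    linarith
  linarith

/-- Finitely many pairwise disjoint positive functionals are almost carried by disjoint parts
of `x`. -/
theorem exists_sum_le_apply_sub_lt {ι : Type*} (μ : ι → WeakDual ℝ E) (h0 : ∀ i, 0 ≤ μ i)
    (hd : ∀ i j, i ≠ j → μ i ⊓ μ j = 0) (s : Finset ι) :
    ∀ {x : E}, 0 ≤ x → ∀ {η : ℝ}, 0 < η →
      ∃ u : ι → E, (∀ i, 0 ≤ u i) ∧ ∑ i ∈ s, u i ≤ x ∧ ∀ i ∈ s, μ i (x - u i) < η := by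
  classical
  induction s using Finset.induction_on with
  | empty => exact fun hx _ _ => ⟨0, fun _ => le_rfl, by simpa using hx, by simp⟩
  | insert k s hk ih =>
    intro x hx η hη
    have hdis : (∑ i ∈ s, μ i) ⊓ μ k = 0 :=
      sum_inf_eq_zero_of_inf_eq_zero s μ (h0 k) (fun i _ => h0 i) fun i hi =>
        hd i k fun h => hk (h ▸ hi)
    -- The part x - a goes to μ k; the other functionals are nearly null there and share a.
    obtain ⟨a, ha0, hax, ha⟩ := exists_apply_sub_add_apply_lt hdis hx (half_pos hη)
    obtain ⟨u, hu0, hus, hu⟩ := ih ha0 (half_pos hη)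
    have hσ0 : 0 ≤ (∑ i ∈ s, μ i) (x - a) :=
      apply_nonneg (Finset.sum_nonneg fun i _ => h0 i) (sub_nonneg.2 hax)
    refine ⟨Function.update u k (x - a), fun i => ?_, ?_, fun i hi => ?_⟩
    · rcases eq_or_ne i k with rfl | hik
      · simpa using hax
      · simpa [hik] using hu0 i
    · rw [Finset.sum_insert hk, Function.update_self, Finset.sum_congr rfl fun i hi =>
        Function.update_of_ne (fun h : i = k => hk (h ▸ hi)) _ _, sub_add, sub_le_self_iff,
        sub_nonneg]
      exact hus
    · rcases Finset.mem_insert.1 hi with rfl | hi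
      · rw [Function.update_self, sub_sub_cancel]
        linarith
      · rw [Function.update_of_ne fun h : i = k => hk (h ▸ hi)]
        have h1 : μ i (x - a) ≤ (∑ i ∈ s, μ i) (x - a) := by
          rw [sum_apply]
          exact Finset.single_le_sum (f := fun i => μ i (x - a))
            (fun j _ => apply_nonneg (h0 j) (sub_nonneg.2 hax)) hi
        have h2 := hu i hi
        have h3 := apply_nonneg (h0 k) ha0
        have h4 : μ i (x - u i) = μ i (x - a) + μ i (a - u i) := by
          rw [← map_add, sub_add_sub_cancel]
        linarith

/-- Pigeonhole: among N > C/δ near-carriers with sum at most x, each μ m gives some one mass below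
δ, so one of them serves infinitely many m. -/
theorem exists_mem_apply_sub_lt_infinite (μ : ℕ → WeakDual ℝ E) (h0 : ∀ i, 0 ≤ μ i)
    (hd : ∀ i j, i ≠ j → μ i ⊓ μ j = 0) {x : E} (hx : 0 ≤ x) {C : ℝ} (hC : ∀ n, μ n x ≤ C)
    {η δ : ℝ} (hη : 0 < η) (hδ : 0 < δ) {M : Set ℕ} (hM : M.Infinite) :
    ∃ n ∈ M, ∃ u, 0 ≤ u ∧ u ≤ x ∧ μ n (x - u) < η ∧
      ∃ M' ⊆ M, M'.Infinite ∧ ∀ m ∈ M', n < m ∧ μ m u < δ := by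
  obtain ⟨N, hN⟩ := exists_nat_gt (C / δ)
  rw [div_lt_iff₀ hδ] at hN
  obtain ⟨s, hsM, hsN⟩ := hM.exists_subset_card_eq N
  obtain ⟨u, hu0, hus, hu⟩ := exists_sum_le_apply_sub_lt μ h0 hd s hx hη
  have hcov : M ⊆ ⋃ i ∈ s, {m ∈ M | μ m (u i) < δ} := by
    intro m hm
    by_contra hcon
    simp only [Set.mem_iUnion, Set.mem_ofPred_eq, not_exists, not_and, not_lt] at hcon
    have h1 : (N : ℝ) * δ ≤ ∑ i ∈ s, μ m (u i) := by
      rw [← hsN, ← nsmul_eq_mul]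
      exact Finset.card_nsmul_le_sum s _ _ fun i hi => hcon i hi hm
    have h2 := apply_mono (h0 m) hus
    rw [map_sum] at h2
    linarith [hC m]
  obtain ⟨i, hi, hinf⟩ : ∃ i ∈ s, {m ∈ M | μ m (u i) < δ}.Infinite := by
    by_contra! hcon
    exact hM ((s.finite_toSet.biUnion fun i hi => hcon i hi).subset hcov)
  refine ⟨i, hsM hi, u i, hu0 i, ?_, hu i hi, {m ∈ M | μ m (u i) < δ} \ Set.Iic i,
    Set.sdiff_subset.trans (Set.sep_subset _ _), hinf.sdiff (Set.finite_Iic i), fun m hm => ?_⟩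
  · exact (Finset.single_le_sum (fun j _ => hu0 j) hi).trans hus
  · exact ⟨not_le.1 hm.2, hm.1.2⟩

/-- Iterating along nested infinite index sets keeps every later functional small on every earlier u
i. -/
theorem exists_strictMono_apply_sub_lt (μ : ℕ → WeakDual ℝ E) (h0 : ∀ i, 0 ≤ μ i)
    (hd : ∀ i j, i ≠ j → μ i ⊓ μ j = 0) {x : E} (hx : 0 ≤ x) {C : ℝ} (hC : ∀ n, μ n x ≤ C)
    {η : ℝ} (hη : 0 < η) {δ : ℕ → ℝ} (hδ : ∀ i, 0 < δ i) :
    ∃ φ : ℕ → ℕ, StrictMono φ ∧ ∃ u : ℕ → E, (∀ j, 0 ≤ u j) ∧ (∀ j, u j ≤ x) ∧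
      (∀ j, μ (φ j) (x - u j) < η) ∧ ∀ i j, i < j → μ (φ j) (u i) < δ i := by
  choose n hn u hu0 hux hu M' hM' hinf hlt using fun (k : ℕ) (M : {M : Set ℕ // M.Infinite}) =>
    exists_mem_apply_sub_lt_infinite μ h0 hd hx hC hη (hδ k) M.2
  let S : ℕ → {M : Set ℕ // M.Infinite} := fun k =>
    Nat.rec ⟨Set.univ, Set.infinite_univ⟩ (fun k M => ⟨M' k M, hinf k M⟩) k
  have hS : ∀ k, (S (k + 1)).1 = M' k (S k) := fun k => rfl
  have hanti : Antitone fun k => (S k).1 := antitone_nat_of_succ_le fun k => by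
    rw [hS]
    exact hM' k (S k)
  have hmem : ∀ i j, i < j → n j (S j) ∈ M' i (S i) := fun i j hij => by
    rw [← hS]
    exact hanti (Nat.succ_le_of_lt hij) (hn j (S j))
  exact ⟨fun k => n k (S k), fun i j hij => (hlt i (S i) _ (hmem i j hij)).1,
    fun k => u k (S k), fun j => hu0 j _, fun j => hux j _, fun j => hu j _,
    fun i j hij => (hlt i (S i) _ (hmem i j hij)).2⟩

/-- A disjoint sequence of positive functionals that is bounded below at `x` has a subsequence that
is bounded below along a disjoint sequence in `[0, x]`. -/
theorem exists_disjoint_le_apply (μ : ℕ → WeakDual ℝ E) (h0 : ∀ i, 0 ≤ μ i)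
    (hd : ∀ i j, i ≠ j → μ i ⊓ μ j = 0) {x : E} (hx : 0 ≤ x) {C : ℝ} (hC : ∀ n, μ n x ≤ C)
    {ε : ℝ} (hε : 0 < ε) (hμ : ∀ n, ε ≤ μ n x) :
    ∃ φ : ℕ → ℕ, StrictMono φ ∧ ∃ y : ℕ → E, (∀ j, 0 ≤ y j) ∧ (∀ j, y j ≤ x) ∧
      (∀ i j, i ≠ j → y i ⊓ y j = 0) ∧ ∀ j, ε / 2 ≤ μ (φ j) (y j) := by
  obtain ⟨φ, hφ, u, hu0, hux, hu, hlt⟩ := exists_strictMono_apply_sub_lt μ h0 hd hx hC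
    (η := ε / 8) (by positivity) (δ := fun i => ε / 8 / 2 / 2 ^ i) (fun i => by positivity)
  -- Doubling gives t i ≤ 2 u i - x and, for i < j, t j ≤ x - 2 u i, so the positive parts are
  -- disjoint. The loss in value is at most 2·ε/8 + 2·ε/8 = ε/2.
  let t : ℕ → E := fun j => u j + u j - x - ∑ i ∈ Finset.range j, (u i + u i)
  have hsum0 : ∀ j, 0 ≤ ∑ i ∈ Finset.range j, (u i + u i) := fun j =>
    Finset.sum_nonneg fun i _ => add_nonneg (hu0 i) (hu0 i)
  have hdis : ∀ i j, i < j → (t j)⁺ ⊓ (t i)⁺ = 0 := by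
    intro i j hij
    apply posPart_inf_posPart_eq_zero
    have h1 : t i ≤ u i + u i - x := sub_le_self _ (hsum0 i)
    have h2 : u i + u i ≤ ∑ i ∈ Finset.range j, (u i + u i) :=
      Finset.single_le_sum (f := fun i => u i + u i)
        (fun i _ => add_nonneg (hu0 i) (hu0 i)) (Finset.mem_range.2 hij)
    calc t j ≤ x + x - x - (u i + u i) :=
          sub_le_sub (sub_le_sub_right (add_le_add (hux j) (hux j)) _) h2
      _ = -(u i + u i - x) := by abel
      _ ≤ -t i := neg_le_neg h1
  refine ⟨φ, hφ, fun j => (t j)⁺, fun j => posPart_nonneg _, fun j => ?_, fun i j hij => ?_,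
    fun j => ?_⟩
  · refine sup_le ?_ hx
    calc t j ≤ x + x - x - 0 :=
          sub_le_sub (sub_le_sub_right (add_le_add (hux j) (hux j)) _) (hsum0 j)
      _ = x := by abel
  · rcases lt_or_gt_of_ne hij with h | h
    · rw [inf_comm]
      exact hdis i j h
    · exact hdis j i h
  · have h1 : μ (φ j) (t j) ≤ μ (φ j) (t j)⁺ := apply_mono (h0 _) (le_posPart _)
    have h2 : t j = x - (x - u j) - (x - u j) - ∑ i ∈ Finset.range j, (u i + u i) := by
      simp only [t]
      abel
    have h3 : ∑ i ∈ Finset.range j, μ (φ j) (u i) ≤ ε / 8 := by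
      calc ∑ i ∈ Finset.range j, μ (φ j) (u i)
          ≤ ∑ i ∈ Finset.range j, ε / 8 / 2 / 2 ^ i :=
            Finset.sum_le_sum fun i hi => (hlt i j (Finset.mem_range.1 hi)).le
        _ ≤ ∑' i : ℕ, ε / 8 / 2 / 2 ^ i :=
            (summable_geometric_two' _).sum_le_tsum _ fun i _ => by positivity
        _ = ε / 8 := tsum_geometric_two' _
    have h4 : μ (φ j) (t j) = μ (φ j) x - 2 * μ (φ j) (x - u j)
        - 2 * ∑ i ∈ Finset.range j, μ (φ j) (u i) := by
      rw [h2, map_sub _ _ (∑ i ∈ _, _), map_sub _ _ (x - u j), map_sub _ x (x - u j), map_sum]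
      simp only [map_add, Finset.sum_add_distrib]
      ring
    rw [h4] at h1
    change _ ≤ μ (φ j) (t j)⁺
    linarith [hμ (φ j), hu j]

/-! ### Weak* convergence along disjoint vectors -/

theorem tendsto_iff_forall_apply {f : ℕ → WeakDual ℝ E} {f₀ : WeakDual ℝ E} :
    Tendsto f atTop (𝓝 f₀) ↔ ∀ x : E, Tendsto (fun n => f n x) atTop (𝓝 (f₀ x)) :=
  WeakBilin.tendsto_iff_forall_eval_tendsto _ ContinuousLinearMap.coe_injective

theorem exists_abs_apply_le [CompleteSpace E] {f : ℕ → WeakDual ℝ E} {f₀ : WeakDual ℝ E}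
    (hf : Tendsto f atTop (𝓝 f₀)) {x : E} (hx : 0 ≤ x) : ∃ C, ∀ n, |f n| x ≤ C := by
  obtain ⟨C, hC⟩ := banach_steinhaus (g := fun n => WeakDual.toStrongDual (f n)) fun y => by
    obtain ⟨B, hB⟩ := ((tendsto_iff_forall_apply.1 hf y).norm).bddAbove_range
    exact ⟨B, fun n => hB ⟨n, rfl⟩⟩
  refine ⟨3 * (C * ‖x‖), fun n => abs_apply_le_of_forall_le _ hx fun y hy hyx => ?_⟩
  have hyx' : ‖y‖ ≤ ‖x‖ := by
    apply norm_le_norm_of_abs_le_abs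
    rwa [abs_of_nonneg hy, abs_of_nonneg hx]
  exact ((WeakDual.toStrongDual (f n)).le_of_opNorm_le (hC n) y).trans
    (mul_le_mul_of_nonneg_left hyx' ((norm_nonneg _).trans (hC n)))

/-- A form of **Phillips' lemma** for order bounded disjoint sequences. -/
theorem tendsto_apply_of_tendsto_zero [CompleteSpace E] (hE : SigmaDedekindComplete E)
    {h : ℕ → WeakDual ℝ E} (hh : Tendsto h atTop (𝓝 0)) {x : E} (hx : 0 ≤ x) {z : ℕ → E}
    (hz0 : ∀ j, 0 ≤ z j) (hzx : ∀ j, z j ≤ x) (hd : ∀ i j, i ≠ j → z i ⊓ z j = 0) :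
    Tendsto (fun k => h k (z k)) atTop (𝓝 0) := by
  obtain ⟨S, hS0, hSx, hS1, hSadd⟩ := hE.exists_supFun hx hz0 hzx hd
  obtain ⟨C, hC⟩ := exists_abs_apply_le hh hx
  by_contra hcon
  simp only [Metric.tendsto_atTop, dist_zero_right, Real.norm_eq_abs, not_forall, not_exists,
    not_lt] at hcon
  obtain ⟨ε, hε, hcon⟩ := hcon
  have hM : {k | ε ≤ |h k (z k)|}.Infinite := by
    refine Set.infinite_of_forall_exists_gt fun N => ?_
    obtain ⟨k, hk, hk'⟩ := hcon (N + 1)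
    exact ⟨k, hk', hk⟩
  obtain ⟨N, hN⟩ := exists_nat_gt (C / (ε / 2))
  rw [div_lt_iff₀ (half_pos hε)] at hN
  obtain ⟨M, hMsub, hMinf, hMlt⟩ := exists_infinite_subset_diff_singleton_lt
    (fun k A => |h k| (S A)) (fun k A => apply_nonneg (abs_nonneg _) (hS0 A))
    (fun k A B hAB => by rw [hSadd A B hAB, map_add]) (half_pos hε) N _ hM
    (fun k _ => ((apply_mono (abs_nonneg _) (hSx _)).trans (hC k)).trans hN.le)
  obtain ⟨K, hK⟩ := Metric.tendsto_atTop.1 (tendsto_iff_forall_apply.1 hh (S M)) (ε / 2)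
    (half_pos hε)
  obtain ⟨k, hkM, hkK⟩ := hMinf.exists_gt K
  have h1 : |h k (S M)| < ε / 2 := by
    have := hK k hkK.le
    rwa [Real.dist_eq, show (0 : WeakDual ℝ E) (S M) = 0 from rfl, sub_zero] at this
  have h2 : S M = z k + S (M \ {k}) := by
    rw [← hS1, ← hSadd _ _ Set.disjoint_sdiff_right,
      Set.union_sdiff_cancel (Set.singleton_subset_iff.2 hkM)]
  have h3 := (abs_apply_le_abs_apply (h k) (hS0 (M \ {k}))).trans_lt (hMlt k hkM)
  have h4 : ε ≤ |h k (z k)| := hMsub hkM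
  have h5 : h k (z k) = h k (S M) - h k (S (M \ {k})) := by rw [h2, map_add, add_sub_cancel_right]
  rw [h5] at h4
  linarith [abs_sub (h k (S M)) (h k (S (M \ {k})))]

/-- Finite sums of the z j stay below x, so ∑ |f| (z j) converges. -/
theorem tendsto_apply_of_disjoint (f : WeakDual ℝ E) {x : E} (hx : 0 ≤ x) {z : ℕ → E}
    (hz0 : ∀ j, 0 ≤ z j) (hzx : ∀ j, z j ≤ x) (hd : ∀ i j, i ≠ j → z i ⊓ z j = 0) :
    Tendsto (fun k => f (z k)) atTop (𝓝 0) := by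
  have hsum : ∀ s : Finset ℕ, ∑ i ∈ s, z i ≤ x := by
    intro s
    induction s using Finset.induction_on with
    | empty => simpa using hx
    | insert k s hk ih =>
      rw [Finset.sum_insert hk, add_comm]
      exact add_le_of_inf_eq_zero (sum_inf_eq_zero_of_inf_eq_zero s z (hz0 k) (fun i _ => hz0 i)
        fun i hi => hd i k fun h => hk (h ▸ hi)) ih (hzx k)
  have h1 : Summable fun k => |f| (z k) :=
    summable_of_sum_le (fun k => apply_nonneg (abs_nonneg f) (hz0 k)) (c := |f| x) fun s => by
      rw [← map_sum]
      exact apply_mono (abs_nonneg f) (hsum s)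
  exact squeeze_zero_norm (fun k => abs_apply_le_abs_apply f (hz0 k)) h1.tendsto_atTop_zero

theorem tendsto_apply_of_tendsto [CompleteSpace E] (hE : SigmaDedekindComplete E)
    {f : ℕ → WeakDual ℝ E} {f₀ : WeakDual ℝ E} (hf : Tendsto f atTop (𝓝 f₀)) {x : E} (hx : 0 ≤ x)
    {z : ℕ → E} (hz0 : ∀ j, 0 ≤ z j) (hzx : ∀ j, z j ≤ x) (hd : ∀ i j, i ≠ j → z i ⊓ z j = 0) :
    Tendsto (fun k => f k (z k)) atTop (𝓝 0) := by
  have hh : Tendsto (fun n => f n - f₀) atTop (𝓝 0) := by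
    simpa using hf.sub_const f₀
  have h1 := (tendsto_apply_of_tendsto_zero hE hh hx hz0 hzx hd).add
    (tendsto_apply_of_disjoint f₀ hx hz0 hzx hd)
  rw [add_zero] at h1
  refine h1.congr fun k => ?_
  exact sub_add_cancel (f k (z k)) (f₀ (z k))

/-! ### Disjoint sequences dominated by a convergent one -/

theorem tendsto_abs_apply_of_disjointSeq [CompleteSpace E] (hE : SigmaDedekindComplete E)
    {f : ℕ → WeakDual ℝ E} {f₀ : WeakDual ℝ E} (hf : Tendsto f atTop (𝓝 f₀))
    {g : ℕ → WeakDual ℝ E} (hg : DisjointSeq g) (hgf : ∀ n, |g n| ≤ |f n|) {x : E} (hx : 0 ≤ x) :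
    Tendsto (fun n => |g n| x) atTop (𝓝 0) := by
  obtain ⟨C, hC⟩ := exists_abs_apply_le hf hx
  by_contra hcon
  simp only [Metric.tendsto_atTop, dist_zero_right, Real.norm_eq_abs, not_forall, not_exists,
    not_lt] at hcon
  obtain ⟨ε, hε, hcon⟩ := hcon
  obtain ⟨ψ, hψ, hψε⟩ := extraction_of_frequently_atTop
    (frequently_atTop.2 fun N => (hcon N).imp fun n h => ⟨h.1, h.2⟩)
  obtain ⟨φ, hφ, y, hy0, hyx, hyd, hyε⟩ := exists_disjoint_le_apply (fun n => |g (ψ n)|)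
    (fun n => abs_nonneg _) (fun i j hij => hg _ _ (hψ.injective.ne hij)) hx
    (fun n => (hgf _ x hx).trans (hC _)) hε
    (fun n => by
      have := hψε n
      rwa [abs_of_nonneg (apply_nonneg (abs_nonneg _) hx)] at this)
  -- Otherwise |f| (y j) ≤ 3ε/8 < ε/2.
  have hz : ∀ j, ∃ z, 0 ≤ z ∧ z ≤ y j ∧ ε / 8 < |f (ψ (φ j)) z| := by
    intro j
    by_contra! h
    have h1 := abs_apply_le_of_forall_le (f (ψ (φ j))) (hy0 j) h
    have h2 := hgf (ψ (φ j)) (y j) (hy0 j)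
    have h3 := hyε j
    linarith
  choose z hz0 hzy hzε using hz
  have h1 := tendsto_apply_of_tendsto hE
    (hf.comp (hψ.tendsto_atTop.comp hφ.tendsto_atTop)) hx hz0 (fun j => (hzy j).trans (hyx j))
    fun i j hij => le_antisymm ((inf_le_inf (hzy i) (hzy j)).trans (hyd i j hij).le)
      (le_inf (hz0 i) (hz0 j))
  obtain ⟨K, hK⟩ := Metric.tendsto_atTop.1 h1 (ε / 8) (by positivity)
  have h2 := hK K le_rfl
  rw [Real.dist_eq, sub_zero] at h2
  exact (h2.trans (hzε K)).false

theorem tendsto_zero_of_abs_le {g k : ℕ → WeakDual ℝ E} (hgk : ∀ n, |k n| ≤ |g n|)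
    (hg : ∀ x : E, 0 ≤ x → Tendsto (fun n => |g n| x) atTop (𝓝 0)) : Tendsto k atTop (𝓝 0) :=
  tendsto_iff_forall_apply.2 fun x => squeeze_zero_norm
    (fun n => (abs_apply_le_abs_apply_abs (k n) x).trans (hgk n |x| (abs_nonneg x)))
    (hg |x| (abs_nonneg x))

end BanachLatticeDual

open BanachLatticeDual in
theorem lemma1 {E : Type*} [NormedAddCommGroup E] [Lattice E] [IsOrderedAddMonoid E]
    [HasSolidNorm E] [NormedSpace ℝ E] [IsOrderedModule ℝ E] [CompleteSpace E]
    (hE : SigmaDedekindComplete E) (f : ℕ → WeakDual ℝ E)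
    (hf : ∃ f₀ : WeakDual ℝ E, Tendsto f atTop (𝓝 f₀)) :
    (∀ g : ℕ → WeakDual ℝ E, DisjointSeq g → (∀ n, |g n| ≤ |f n|) →
      Tendsto g atTop (𝓝 0) ∧
      Tendsto (fun n => |g n|) atTop (𝓝 0) ∧
      Tendsto (fun n => (g n)⁺) atTop (𝓝 0) ∧
      Tendsto (fun n => (g n)⁻) atTop (𝓝 0)) ∧
    (DisjointSeq f →
      Tendsto f atTop (𝓝 0) ∧
      Tendsto (fun n => |f n|) atTop (𝓝 0) ∧
      Tendsto (fun n => (f n)⁺) atTop (𝓝 0) ∧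
      Tendsto (fun n => (f n)⁻) atTop (𝓝 0)) := by
  obtain ⟨f₀, hf₀⟩ := hf
  have main : ∀ g : ℕ → WeakDual ℝ E, DisjointSeq g → (∀ n, |g n| ≤ |f n|) →
      Tendsto g atTop (𝓝 0) ∧ Tendsto (fun n => |g n|) atTop (𝓝 0) ∧
      Tendsto (fun n => (g n)⁺) atTop (𝓝 0) ∧ Tendsto (fun n => (g n)⁻) atTop (𝓝 0) := by
    intro g hg hgf
    have h : ∀ x : E, 0 ≤ x → Tendsto (fun n => |g n| x) atTop (𝓝 0) := fun x hx =>
      tendsto_abs_apply_of_disjointSeq hE hf₀ hg hgf hx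
    refine ⟨tendsto_zero_of_abs_le (fun n => le_rfl) h,
      tendsto_zero_of_abs_le (fun n => (abs_abs _).le) h,
      tendsto_zero_of_abs_le (fun n => ?_) h, tendsto_zero_of_abs_le (fun n => ?_) h⟩
    · rw [abs_of_nonneg (posPart_nonneg _)]
      exact sup_le (le_abs_self _) (abs_nonneg _)
    · rw [abs_of_nonneg (negPart_nonneg _)]
      exact sup_le (neg_le_abs _) (abs_nonneg _)
  exact ⟨main, fun hd => main f hd fun n => le_rfl⟩
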